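/- Let $\Gamma_{16}$ be the binary Hamming graph, with vertex set $\mathbb F_2^{16}$ and two vectors adjacent when they differ in exactly one entry. Every automorphism of $\Gamma_{16}$ is uniquely a product $g\sigma$ of a translation $g$ and a permutation $\sigma$ of the $16$ coordinates. For a code $C\subseteq\mathbb F_2^{16}$ let $\mathrm{Aut}(C)$ be the setwise stabiliser of $C$ in $\mathrm{Aut}(\Gamma_{16})$, and let $\mu:\mathrm{Aut}(C)\to S_{16}$, $g\sigma\mapsto\sigma$, be its action on the coordinates. Let $\mathcal G\subseteq\mathbb F_2^{24}$ be the extended binary Golay code, with its coordinates ordered so that $(1^8,0^{16})\in\mathcal G$. For $1\le i\le 7$ let $u_i\in\mathbb F_2^8$ be the vector with support $\{i,8\}$, and let $u_0=0$. Write $u\alpha\in\mathbb F_2^{24}$ for the concatenation of $u\in\mathbb F_2^8$ and $\alpha\in\mathbb F_2^{16}$. The Nordstrom-Robinson code is $$\mathcal{NR}=\{\alpha\in\mathbb F_2^{16} : u_i\alpha\in\mathcal G\text{ for some }i\in\{0,\dots,7\}\};$$ put $\mathcal R=\{\alpha\in\mathbb F_2^{16} : u_0\alpha\in\mathcal G\}$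 and let $K$ be the kernel of $\mu:\mathrm{Aut}(\mathcal{NR})\to S_{16}$. Then: 1. $\mathcal R\subseteq\mathcal{NR}$ is a linear code which, for a suitable labelling of the $16$ coordinates by the points of $\mathbb F_2^4$, is the first order Reed-Muller code $R(1,4)$, that is, the set of value vectors of all polynomials of degree at most $1$ in $4$ variables over $\mathbb F_2$; 2. $K$ is the group of all translations $\alpha\mapsto\alpha+\beta$ with $\beta\in\mathcal R$, and $|K|=2^5$; 3. $\mathrm{Aut}(\mathcal{NR})/K\cong 2^4{:}A_8$, a semidirect product of the elementary abelian group of order $2^4$ by the alternating group $A_8$ acting faithfully on it. -/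

import Mathlib

/-- The vertex set of the binary Hamming graph of length `m`, as a vector space over `F_2`. -/
abbrev BinVec (m : ℕ) : Type := Fin m → ZMod 2

/-- The binary Hamming graph: two vectors are adjacent iff they differ in precisely one entry. -/
def hammingGraph (m : ℕ) : SimpleGraph (BinVec m) where
  Adj α β := hammingDist α β = 1
  symm := ⟨fun α β h => by rw [hammingDist_comm]; exact h⟩
  loopless := ⟨fun α h => by simp at h⟩

/-- The full automorphism group of the binary Hamming graph (the product is composition). -/
abbrev HammingAut (m : ℕ) : Type := hammingGraph m ≃g hammingGraph m

/-- The translation `α ↦ α + β`. -/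
def translation {m : ℕ} (β : BinVec m) : HammingAut m where
  toEquiv := Equiv.addRight β
  map_rel_iff' := by
    intro a b
    simp [hammingGraph, hammingDist]

/-- Translations form a group isomorphic to the additive group of vectors. -/
def translationHom (m : ℕ) : Multiplicative (BinVec m) →* HammingAut m where
  toFun β := translation β.toAdd
  map_one' := by
    ext α i
    simp [translation]
  map_mul' β γ := by
    apply RelIso.ext
    intro α
    change α + (β.toAdd + γ.toAdd) = (α + γ.toAdd) + β.toAdd
    rw [add_assoc, add_comm γ.toAdd]

/-- The group of translations by the vectors of a linear code. -/
def translationGroup {m : ℕ} (R : Submodule (ZMod 2) (BinVec m)) : Subgroup (HammingAut m) :=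
  (AddSubgroup.toSubgroup R.toAddSubgroup).map (translationHom m)

/-- The automorphism group of a code: its setwise stabiliser in the automorphism group of the
Hamming graph. -/
def codeAut {m : ℕ} (C : Set (BinVec m)) : Subgroup (HammingAut m) where
  carrier := {x | (fun α => x α) '' C = C}
  one_mem' := by simp
  mul_mem' := by
    intro x y hx hy
    change (fun α => x (y α)) '' C = C
    rw [← Set.image_image (fun α => x α) (fun α => y α) C]
    rw [Set.mem_ofPred_eq] at hx hy
    rw [hy, hx]
  inv_mem' := by
    intro x hx
    rw [Set.mem_ofPred_eq] at hx
    change (fun α => x⁻¹ α) '' C = C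
    conv_lhs => rw [← hx]
    rw [Set.image_image]
    simp

/-! ### The action of the automorphism group of the Hamming graph on coordinates -/

theorem hammingDist_map_le {m : ℕ} (x : HammingAut m) (n : ℕ) :
    ∀ α β : BinVec m, hammingDist α β = n → hammingDist (x α) (x β) ≤ n := by
  induction n with
  | zero =>
    intro α β h
    rw [hammingDist_eq_zero] at h
    simp [h]
  | succ n ih =>
    intro α β h
    have hne : α ≠ β := by
      rintro rfl
      simp at h
    obtain ⟨i, hi⟩ := Function.ne_iff.mp hne
    have h1 : hammingDist α (Function.update α i (β i)) = 1 := by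
      rw [hammingDist, Finset.card_eq_one]
      refine ⟨i, ?_⟩
      ext j
      by_cases hj : j = i
      · subst hj; simpa using hi
      · simp [hj]
    have h2 : hammingDist (Function.update α i (β i)) β = n := by
      have : ({j | Function.update α i (β i) j ≠ β j} : Finset (Fin m))
          = ({j | α j ≠ β j} : Finset (Fin m)).erase i := by
        ext j
        by_cases hj : j = i
        · subst hj; simp
        · simp [hj]
      rw [hammingDist, this, Finset.card_erase_of_mem (by simpa using hi)]
      rw [hammingDist] at h
      omega
    have h3 : hammingDist (x α) (x (Function.update α i (β i))) = 1 :=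
      x.map_rel_iff.mpr h1
    have h4 := ih _ _ h2
    have h5 := hammingDist_triangle (x α) (x (Function.update α i (β i))) (x β)
    omega

theorem hammingDist_map {m : ℕ} (x : HammingAut m) (α β : BinVec m) :
    hammingDist (x α) (x β) = hammingDist α β := by
  apply le_antisymm (hammingDist_map_le x _ α β rfl)
  have h := hammingDist_map_le x.symm _ (x α) (x β) rfl
  simpa using h

theorem hammingDist_add_single {m : ℕ} (α β : BinVec m) (i : Fin m) :
    (α i = β i → hammingDist α (β + Pi.single i 1) = hammingDist α β + 1) ∧
    (α i ≠ β i → hammingDist α (β + Pi.single i 1) + 1 = hammingDist α β) := by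
  have key : ∀ a b : ZMod 2, a ≠ b → a = b + 1 := by decide
  have key2 : ∀ b : ZMod 2, b ≠ b + 1 := by decide
  constructor
  · intro h
    have : ({j | α j ≠ (β + Pi.single i 1 : BinVec m) j} : Finset (Fin m))
        = insert i ({j | α j ≠ β j} : Finset (Fin m)) := by
      ext j
      by_cases hj : j = i
      · subst hj; simp [h, key2]
      · simp [hj]
    rw [hammingDist, this, Finset.card_insert_of_notMem (by simp [h]), hammingDist]
  · intro h
    have : ({j | α j ≠ (β + Pi.single i 1 : BinVec m) j} : Finset (Fin m))
        = ({j | α j ≠ β j} : Finset (Fin m)).erase i := by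
      ext j
      by_cases hj : j = i
      · subst hj; simp [key _ _ h]
      · simp [hj]
    have hi : i ∈ ({j | α j ≠ β j} : Finset (Fin m)) := by simpa using h
    rw [hammingDist, this, Finset.card_erase_add_one hi, hammingDist]

theorem exists_eq_add_single {m : ℕ} (α β : BinVec m) (h : hammingDist α β = 1) :
    ∃ i, β = α + Pi.single i 1 := by
  rw [hammingDist, Finset.card_eq_one] at h
  obtain ⟨i, hi⟩ := h
  refine ⟨i, ?_⟩
  have key : ∀ a b : ZMod 2, a ≠ b → b = a + 1 := by decide
  ext j
  have hj := Finset.ext_iff.mp hi j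
  simp only [Finset.mem_filter, Finset.mem_univ, true_and, Finset.mem_singleton] at hj
  by_cases hji : j = i
  · subst hji; simpa using key _ _ (hj.mpr rfl)
  · have := not_not.mp (fun hne => hji (hj.mp hne))
    simp [hji, this]

/-- Every automorphism of the Hamming graph is a coordinate permutation followed by a
translation: the entry in position `i` is moved to position `σ i`. -/
theorem exists_coordPerm {m : ℕ} (x : HammingAut m) :
    ∃ σ : Equiv.Perm (Fin m), ∀ α i, x α (σ i) = α i + x 0 (σ i) := by
  have h : ∀ i : Fin m, ∃ j, x (Pi.single i 1) = x 0 + Pi.single j 1 := by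
    intro i
    apply exists_eq_add_single
    rw [hammingDist_map]
    simpa using (hammingDist_add_single (0 : BinVec m) 0 i).1 rfl
  choose f hf using h
  have hinj : Function.Injective f := by
    intro i j hij
    have h1 : x (Pi.single i 1) = x (Pi.single j 1) := by rw [hf, hf, hij]
    have h2 := congrFun (x.injective h1) i
    by_contra hne
    simp [hne] at h2
  refine ⟨Equiv.ofBijective f (Finite.injective_iff_bijective.mp hinj), ?_⟩
  intro α i
  rw [Equiv.ofBijective_apply]
  have h0 := hammingDist_map x α 0
  have h1 := hammingDist_map x α (Pi.single i 1)
  rw [hf] at h1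
  have ha := hammingDist_add_single (x α) (x 0) (f i)
  have hb := hammingDist_add_single α 0 i
  rw [zero_add] at hb
  have key : ∀ a b : ZMod 2, a ≠ b → a = 1 + b := by decide
  have key2 : ∀ a : ZMod 2, a ≠ 0 → a = 1 := by decide
  by_cases hc : α i = 0
  · have hb1 := hb.1 hc
    rw [hc, zero_add]
    by_contra hne
    have := ha.2 hne
    omega
  · have hb1 := hb.2 hc
    rw [key2 _ hc]
    apply key
    intro heq
    have := ha.1 heq
    omega

theorem coordPerm_unique {m : ℕ} (x : HammingAut m) (σ τ : Equiv.Perm (Fin m))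
    (hσ : ∀ α i, x α (σ i) = α i + x 0 (σ i)) (hτ : ∀ α i, x α (τ i) = α i + x 0 (τ i)) :
    σ = τ := by
  ext1 i
  have h1 := hσ (Pi.single i 1) i
  have h2 := hτ (Pi.single i 1) (τ.symm (σ i))
  rw [Equiv.apply_symm_apply, h1] at h2
  have h3 := add_right_cancel h2
  by_contra hne
  have : τ.symm (σ i) ≠ i := fun h => hne (by rw [← h, Equiv.apply_symm_apply, h])
  simp [this] at h3

/-- The homomorphism from the automorphism group of the Hamming graph to the symmetric group on
the coordinates, sending `g σ` (with `g` a translation and `σ` a coordinate permutation)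
to `σ`. -/
noncomputable def coordPermHom (m : ℕ) : HammingAut m →* Equiv.Perm (Fin m) where
  toFun x := (exists_coordPerm x).choose
  map_one' := coordPerm_unique 1 _ _ (exists_coordPerm 1).choose_spec (by simp)
  map_mul' x y := by
    apply coordPerm_unique (x * y) _ _ (exists_coordPerm (x * y)).choose_spec
    have hx := (exists_coordPerm x).choose_spec
    have hy := (exists_coordPerm y).choose_spec
    intro α i
    simp only [Equiv.Perm.mul_apply, RelIso.mul_apply]
    rw [hx, hy, hx (y 0), add_assoc]

theorem coordPermHom_spec {m : ℕ} (x : HammingAut m) (α : BinVec m) (i : Fin m) :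
    x α (coordPermHom m x i) = α i + x 0 (coordPermHom m x i) :=
  (exists_coordPerm x).choose_spec α i

/-- The action of the automorphism group of a code on the coordinates. -/
noncomputable def codeCoordAction {m : ℕ} (C : Set (BinVec m)) :
    codeAut C →* Equiv.Perm (Fin m) :=
  (coordPermHom m).comp (codeAut C).subtype

/-! ### The codes -/

/-- The coefficient vector of `X ^ k * (X ^ 11 + X ^ 10 + X ^ 6 + X ^ 5 + X ^ 4 + X ^ 2 + 1)` in
the positions `0, …, 22`, followed by an overall parity check in position `23`. -/
def golayRow (k : Fin 12) : BinVec 24 := fun j =>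
  if j.val = 23 ∨ ∃ s ∈ ({0, 2, 4, 5, 6, 10, 11} : Finset ℕ), j.val = k.val + s then 1 else 0

/-- The extended binary Golay code in its standard coordinates: the cyclic code of length `23`
with generator polynomial `X ^ 11 + X ^ 10 + X ^ 6 + X ^ 5 + X ^ 4 + X ^ 2 + 1`,
extended by a parity check. -/
def standardGolay : Submodule (ZMod 2) (BinVec 24) :=
  Submodule.span (ZMod 2) (Set.range golayRow)

/-- `G` is the extended binary Golay code, for some ordering of the coordinates. -/
def IsExtendedGolay (G : Submodule (ZMod 2) (BinVec 24)) : Prop :=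
  ∃ σ : Equiv.Perm (Fin 24), ∀ α : BinVec 24, α ∈ G ↔ (fun i => α (σ i)) ∈ standardGolay

/-- The concatenation of a vector of length `8` and a vector of length `16`. -/
def concat (u : BinVec 8) (α : BinVec 16) : BinVec 24 := Fin.append u α

/-- The vector of length `8` with support `{i, 8}` if `i ∈ {1, …, 7}`, and the zero vector if
`i = 8` (in the labelling of the coordinates by `1, …, 8`). -/
def headVec (i : Fin 8) : BinVec 8 := fun j => if i ≠ 7 ∧ (j = i ∨ j = 7) then 1 else 0

/-- The Nordstrom-Robinson code: the projections to the last `16` coordinates of all codewords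
of the Golay code `G` whose first `8` coordinates are zero or have support `{i, 8}` with
`1 ≤ i ≤ 7`. -/
def nordstromRobinson (G : Submodule (ZMod 2) (BinVec 24)) : Set (BinVec 16) :=
  {α | ∃ i : Fin 8, concat (headVec i) α ∈ G}

/-- The subcode of the Nordstrom-Robinson code obtained from the codewords of `G` that vanish on
the first `8` coordinates. -/
def reedSubcode (G : Submodule (ZMod 2) (BinVec 24)) : Submodule (ZMod 2) (BinVec 16) where
  carrier := {α | concat 0 α ∈ G}
  zero_mem' := by
    have : concat 0 0 = 0 := by
      ext i
      refine Fin.addCases (m := 8) (n := 16) (fun j => ?_) (fun j => ?_) i <;> simp [concat]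
    rw [Set.mem_ofPred_eq, this]
    exact G.zero_mem
  add_mem' := by
    intro α β hα hβ
    have : concat 0 (α + β) = concat 0 α + concat 0 β := by
      ext i
      refine Fin.addCases (m := 8) (n := 16) (fun j => ?_) (fun j => ?_) i <;> simp [concat]
    rw [Set.mem_ofPred_eq, this]
    exact G.add_mem hα hβ
  smul_mem' := by
    intro c α hα
    have : concat 0 (c • α) = c • concat 0 α := by
      ext i
      refine Fin.addCases (m := 8) (n := 16) (fun j => ?_) (fun j => ?_) i <;> simp [concat]
    rw [Set.mem_ofPred_eq, this]
    exact G.smul_mem c hα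

/-- `R` is the first order Reed-Muller code `R(1, 4)`, for some labelling of the `16` coordinates
by the points of `F_2^4`: its codewords are the value vectors of the polynomials of degree at
most `1` in `4` variables. -/
def IsReedMullerOneFour (R : Submodule (ZMod 2) (BinVec 16)) : Prop :=
  ∃ e : Fin 16 ≃ (Fin 4 → ZMod 2), ∀ α : BinVec 16,
    α ∈ R ↔ ∃ (a : Fin 4 → ZMod 2) (b : ZMod 2), ∀ i, α i = ∑ k, a k * e i k + b

/-!
The argument uses only three properties of the extended Golay code `G` (`IsGolayLike`): it is
self-dual, all weights are divisible by `4`, and the minimum distance is `8`. These are read off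
from the generator matrix (a word of weight `4` would be a linear relation between four of its
columns) and do not depend on the ordering of the coordinates.

Let `O` be the octad of the first `8` coordinates and `R` the Reed-Muller subcode. By self-duality
the heads of codewords are the vectors of even weight (`IsGolayLike.exists_tail`), the tails form
the dual of `R` (`IsGolayLike.dualCode_reedSubcode`), and a tail determines its head up to
complementation in `O` (`IsGolayLike.head_unique`). So `R` has dimension `5`, contains the all-one
word and separates the `16` coordinates, since its dual has no word of weight `2`; a code with
these properties is `R(1,4)`.

The kernel of the action on coordinates consists of the translations preserving the code. A
translation by a word with head `{i, 8}` would produce heads `{i, j}`, so only the translations by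
`R` remain. As the kernel is normal, the permutations induced by automorphisms preserve `R`, hence
are affine permutations of `F_2^4`. Conversely a permutation preserving `R` preserves its dual, so
it permutes the heads modulo complementation. Weights modulo `4` show that it takes heads of weight
`2` to heads of weight `2`, and three concurrent pairs never to a triangle; such a map on the pairs
of points of `O` comes from a permutation of `O` (`exists_perm_of_star`). Thus the permutation
extends to an automorphism of `G` fixing `O` (`IsGolayLike.exists_preservesPair`), and after
composition with a translation it preserves the Nordstrom-Robinson code. Hence the image of the
action is the affine group `2^4 : GL(4,2)`.

The same extension gives a homomorphism `GL(4,2) → S_8`. It is injective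
(`IsGolayLike.eq_self_of_preservesPair_one`), so by the order of `GL(4,2)` the image has index `2`
and is `A_8`. Transporting the natural action of `GL(4,2)` along this isomorphism yields
`2^4 : A_8`.
-/

/-! ### Weights and dual codes -/

/-- The Hamming weight of a binary vector. -/
def wt {n : ℕ} (x : BinVec n) : ℕ := ∑ i, (x i).val

/-- The dual code: all vectors orthogonal to the code for the standard bilinear form. -/
def dualCode {n : ℕ} (C : Submodule (ZMod 2) (BinVec n)) : Submodule (ZMod 2) (BinVec n) :=
  C.dualAnnihilator.comap (dotProductEquiv (ZMod 2) (Fin n)).toLinearMap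

theorem mem_dualCode {n : ℕ} {C : Submodule (ZMod 2) (BinVec n)} {y : BinVec n} :
    y ∈ dualCode C ↔ ∀ x ∈ C, y ⬝ᵥ x = 0 := by
  simp [dualCode, Submodule.mem_dualAnnihilator]

theorem finrank_add_finrank_dualCode {n : ℕ} (C : Submodule (ZMod 2) (BinVec n)) :
    Module.finrank (ZMod 2) C + Module.finrank (ZMod 2) (dualCode C) = n := by
  have h := Subspace.finrank_add_finrank_dualAnnihilator_eq C
  have h2 : Module.finrank (ZMod 2) (dualCode C) = Module.finrank (ZMod 2) C.dualAnnihilator := by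
    rw [dualCode, Submodule.comap_equiv_eq_map_symm]
    exact LinearEquiv.finrank_map_eq _ _
  rwa [Module.finrank_fin_fun, ← h2] at h

/-- A code contains its double dual. -/
theorem mem_of_orthogonal_dualCode {n : ℕ} {C : Submodule (ZMod 2) (BinVec n)} {x : BinVec n}
    (h : ∀ y ∈ dualCode C, y ⬝ᵥ x = 0) : x ∈ C := by
  by_contra hx
  obtain ⟨f, hf, hC⟩ := Submodule.exists_le_ker_of_notMem hx
  apply hf
  obtain ⟨y, rfl⟩ := (dotProductEquiv (ZMod 2) (Fin n)).surjective f
  exact h y (mem_dualCode.2 fun z hz => hC hz)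

theorem binVec_add_self {n : ℕ} (x : BinVec n) : x + x = 0 := by
  ext i
  exact CharTwo.add_self_eq_zero (x i)

theorem binVec_add_add_cancel {n : ℕ} (x y : BinVec n) : x + (x + y) = y := by
  rw [← add_assoc, binVec_add_self, zero_add]

theorem binVec_eq_of_add_eq_zero {n : ℕ} {x y : BinVec n} (h : x + y = 0) : x = y := by
  rw [← binVec_add_add_cancel y x, add_comm y x, h, add_zero]

theorem wt_add {n : ℕ} (x y : BinVec n) : wt (x + y) + 2 * wt (x * y) = wt x + wt y := by
  have key : ∀ a b : ZMod 2, (a + b).val + 2 * (a * b).val = a.val + b.val := by decide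
  simp only [wt, Finset.mul_sum, ← Finset.sum_add_distrib, Pi.add_apply, Pi.mul_apply, key]

theorem wt_cast {n : ℕ} (x : BinVec n) : (wt x : ZMod 2) = ∑ i, x i := by
  simp [wt]

theorem two_dvd_wt_mul_iff {n : ℕ} (x y : BinVec n) : 2 ∣ wt (x * y) ↔ x ⬝ᵥ y = 0 := by
  rw [← ZMod.natCast_eq_zero_iff, wt_cast]
  rfl

theorem two_dvd_wt_iff {n : ℕ} (x : BinVec n) : 2 ∣ wt x ↔ x ⬝ᵥ 1 = 0 := by
  rw [← two_dvd_wt_mul_iff, mul_one]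

@[simp] theorem wt_zero {n : ℕ} : wt (0 : BinVec n) = 0 := by simp [wt]

theorem wt_comp {n : ℕ} (x : BinVec n) (σ : Equiv.Perm (Fin n)) : wt (x ∘ σ) = wt x :=
  Equiv.sum_comp σ fun i => (x i).val

theorem wt_eq_zero_iff {n : ℕ} {x : BinVec n} : wt x = 0 ↔ x = 0 := by
  simp [wt, funext_iff]

theorem wt_single {n : ℕ} (i : Fin n) : wt (Pi.single i 1 : BinVec n) = 1 := by
  have key : ∀ j, ((Pi.single i 1 : BinVec n) j).val = if j = i then 1 else 0 := by
    intro j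
    by_cases h : j = i
    · subst h
      simp only [Pi.single_eq_same, if_true]
      rfl
    · simp [h]
  simp [wt, key]

theorem wt_eq_card {n : ℕ} (x : BinVec n) : wt x = (Finset.univ.filter (x · ≠ 0)).card := by
  have key : ∀ a : ZMod 2, a.val = if a ≠ 0 then 1 else 0 := by decide
  simp only [wt, key, Finset.card_filter]

theorem binVec_eq_sum_single {n : ℕ} (x : BinVec n) :
    x = ∑ i ∈ Finset.univ.filter (x · ≠ 0), Pi.single i 1 := by
  ext j
  have key : ∀ a : ZMod 2, a ≠ 0 → a = 1 := by decide
  by_cases h : x j = 0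
  · simp [Finset.sum_apply, Pi.single_apply, h]
  · simp [Finset.sum_apply, Pi.single_apply, key _ h]

/-! ### The extended binary Golay code -/

/-- The properties of the extended binary Golay code on which everything below rests: it is
self-dual and doubly even, and it has minimum distance at least `8`. -/
structure IsGolayLike (G : Submodule (ZMod 2) (BinVec 24)) : Prop where
  dual_eq : dualCode G = G
  four_dvd : ∀ x ∈ G, 4 ∣ wt x
  eq_zero_of_wt_lt : ∀ x ∈ G, wt x < 8 → x = 0

theorem golayRow_dotProduct : ∀ k l : Fin 12, golayRow k ⬝ᵥ golayRow l = 0 := by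
  unfold golayRow
  decide +kernel

theorem four_dvd_wt_golayRow : ∀ k : Fin 12, 4 ∣ wt (golayRow k) := by
  unfold golayRow wt
  decide +kernel

/-- The generator matrix is in echelon form. -/
theorem linearIndependent_golayRow : LinearIndependent (ZMod 2) golayRow := by
  have key : ∀ l : Fin 12, golayRow l (Fin.castLE (by norm_num) l) = 1 ∧
      ∀ k : Fin 12, l < k → golayRow k (Fin.castLE (by norm_num) l) = 0 := by
    unfold golayRow
    decide +kernel
  rw [Fintype.linearIndependent_iff]
  intro g hg
  by_contra! h
  obtain ⟨l, hl⟩ := h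
  -- Look at the pivot position of the first row with a nonzero coefficient.
  obtain ⟨l, hl, hmin⟩ := WellFounded.has_min (wellFounded_lt (α := Fin 12)) {l | g l ≠ 0} ⟨l, hl⟩
  apply hl
  have h1 := congrFun hg (Fin.castLE (by norm_num) l)
  rw [Finset.sum_apply, Finset.sum_eq_single l] at h1
  · simpa [(key l).1] using h1
  · intro k _ hk
    rcases lt_or_gt_of_ne hk with hkl | hkl
    · have : g k = 0 := by
        by_contra h0
        exact hmin k h0 hkl
      simp [this]
    · simp [(key l).2 k hkl]
  · simp

theorem dualCode_standardGolay : dualCode standardGolay = standardGolay := by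
  have hle : standardGolay ≤ dualCode standardGolay := by
    intro x hx
    rw [mem_dualCode]
    intro y hy
    refine Submodule.span_induction₂ (p := fun x y _ _ => x ⬝ᵥ y = 0) ?_ ?_ ?_ ?_ ?_ ?_ ?_ hx hy
    · rintro _ _ ⟨k, rfl⟩ ⟨l, rfl⟩
      exact golayRow_dotProduct k l
    all_goals simp +contextual
  have h12 : Module.finrank (ZMod 2) standardGolay = 12 := by
    exact finrank_span_eq_card linearIndependent_golayRow
  have := finrank_add_finrank_dualCode standardGolay
  exact (Submodule.eq_of_le_of_finrank_eq hle (by omega)).symm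

theorem four_dvd_wt_standardGolay : ∀ x ∈ standardGolay, 4 ∣ wt x := by
  intro x hx
  induction hx using Submodule.span_induction with
  | mem x h =>
    obtain ⟨k, rfl⟩ := h
    exact four_dvd_wt_golayRow k
  | zero => simp
  | add x y hx hy h1 h2 =>
    have h3 := wt_add x y
    have h4 : 2 ∣ wt (x * y) := by
      rw [two_dvd_wt_mul_iff]
      have hx' : x ∈ dualCode standardGolay := by rw [dualCode_standardGolay]; exact hx
      exact mem_dualCode.1 hx' y hy
    omega
  | smul a x hx h =>
    have : ∀ a : ZMod 2, a = 0 ∨ a = 1 := by decide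
    rcases this a with rfl | rfl <;> simp [h]

/-- The columns of the generator matrix, read as numbers in base two with the entry in row `k`
as the digit of weight `2 ^ k`. -/
def golayColumn (j : Fin 24) : ℕ :=
  ![1, 2, 5, 10, 21, 43, 87, 174, 348, 696, 1393, 2787, 1478, 2956, 1816, 3632, 3168, 2240, 384,
    768, 1536, 3072, 2048, 4095] j

theorem golayRow_eq_testBit : ∀ (j : Fin 24) (k : Fin 12),
    golayRow k j = ((golayColumn j).testBit k).toNat := by
  unfold golayRow
  decide +kernel

theorem golayColumn_lt : ∀ j : Fin 24, golayColumn j < 2 ^ 12 := by decide +kernel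

theorem golayColumn_xor_ne_zero : ∀ a b : Fin 24, a < b → ∀ c, b < c → ∀ d, c < d →
    golayColumn a ^^^ golayColumn b ^^^ golayColumn c ^^^ golayColumn d ≠ 0 := by
  decide +kernel

/-- By self-duality a word of weight four would be a linear relation between four columns of the
generator matrix. -/
theorem wt_ne_four_of_mem_standardGolay {x : BinVec 24} (hx : x ∈ standardGolay) : wt x ≠ 4 := by
  intro h4
  rw [wt_eq_card] at h4
  set f := (Finset.univ.filter (x · ≠ 0)).orderEmbOfFin h4
  have hx2 : x = ∑ i, Pi.single (f i) 1 := by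
    conv_lhs => rw [binVec_eq_sum_single x, ← Finset.map_orderEmbOfFin_univ _ h4]
    rw [Finset.sum_map]
    rfl
  have hlt : ∀ i j : Fin 4, i < j → f i < f j := fun i j h => f.strictMono h
  refine golayColumn_xor_ne_zero _ _ (hlt 0 1 (by decide)) _ (hlt 1 2 (by decide)) _
    (hlt 2 3 (by decide)) ?_
  rw [← dualCode_standardGolay, mem_dualCode] at hx
  have key : ∀ p q r s : Bool, ((p.toNat : ZMod 2) + q.toNat + r.toNat + s.toNat = 0) →
      (((p ^^ q) ^^ r) ^^ s) = false := by decide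
  apply Nat.eq_of_testBit_eq
  intro k
  rw [Nat.zero_testBit, Nat.testBit_xor, Nat.testBit_xor, Nat.testBit_xor]
  by_cases hk : k < 12
  · have h := hx (golayRow ⟨k, hk⟩) (Submodule.subset_span ⟨_, rfl⟩)
    rw [hx2, sum_dotProduct, Fin.sum_univ_four] at h
    simp only [single_one_dotProduct, golayRow_eq_testBit] at h
    exact key _ _ _ _ h
  · have h0 : ∀ j, (golayColumn j).testBit k = false := fun j =>
      Nat.testBit_lt_two_pow ((golayColumn_lt j).trans_le
        (Nat.pow_le_pow_right (by norm_num) (by omega)))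
    simp [h0]

theorem isGolayLike_standardGolay : IsGolayLike standardGolay where
  dual_eq := dualCode_standardGolay
  four_dvd := four_dvd_wt_standardGolay
  eq_zero_of_wt_lt x hx h8 := by
    have h1 := four_dvd_wt_standardGolay x hx
    have h2 := wt_ne_four_of_mem_standardGolay hx
    exact wt_eq_zero_iff.1 (by omega)

theorem IsExtendedGolay.isGolayLike {G : Submodule (ZMod 2) (BinVec 24)}
    (hG : IsExtendedGolay G) : IsGolayLike G := by
  obtain ⟨σ, hσ⟩ := hG
  have hσ' : ∀ x : BinVec 24, x ∈ standardGolay ↔ x ∘ σ.symm ∈ G := by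
    intro x
    rw [hσ]
    simp
  have hS := isGolayLike_standardGolay
  refine ⟨?_, fun x hx => ?_, fun x hx h8 => ?_⟩
  · ext x
    rw [hσ, ← hS.dual_eq, mem_dualCode, mem_dualCode]
    constructor
    · intro h y hy
      rw [← h _ ((hσ' y).1 hy), dotProduct_comp_equiv_symm]
      rfl
    · intro h y hy
      rw [← h _ ((hσ y).1 hy)]
      exact (comp_equiv_dotProduct_comp_equiv x y σ).symm
  · rw [← wt_comp x σ]
    exact hS.four_dvd _ ((hσ x).1 hx)
  · have h := hS.eq_zero_of_wt_lt _ ((hσ x).1 hx) (by rwa [← wt_comp x σ] at h8)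
    ext i
    simpa using congrFun h (σ.symm i)

/-! ### Heads and tails of the codewords -/

theorem concat_add (u v : BinVec 8) (α β : BinVec 16) :
    concat (u + v) (α + β) = concat u α + concat v β := by
  ext i
  refine Fin.addCases (m := 8) (n := 16) (fun j => ?_) (fun j => ?_) i <;> simp [concat]

theorem concat_zero : concat 0 0 = 0 := by
  ext i
  refine Fin.addCases (m := 8) (n := 16) (fun j => ?_) (fun j => ?_) i <;> simp [concat]

theorem wt_concat (u : BinVec 8) (α : BinVec 16) : wt (concat u α) = wt u + wt α := by
  simp only [wt, concat]
  rw [Fin.sum_univ_add (a := 8) (b := 16)]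
  simp

theorem concat_dotProduct (u v : BinVec 8) (α β : BinVec 16) :
    concat u α ⬝ᵥ concat v β = u ⬝ᵥ v + α ⬝ᵥ β := by
  simp only [dotProduct, concat]
  rw [Fin.sum_univ_add (a := 8) (b := 16)]
  simp

/-- The projection onto the first `8` coordinates. -/
def headMap : BinVec 24 →ₗ[ZMod 2] BinVec 8 := LinearMap.funLeft _ _ (Fin.castAdd 16)

/-- The projection onto the last `16` coordinates. -/
def tailMap : BinVec 24 →ₗ[ZMod 2] BinVec 16 := LinearMap.funLeft _ _ (Fin.natAdd 8)

theorem concat_head_tail (x : BinVec 24) : concat (headMap x) (tailMap x) = x :=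
  Fin.append_castAdd_natAdd

theorem headMap_concat (u : BinVec 8) (α : BinVec 16) : headMap (concat u α) = u := by
  ext i
  exact Fin.append_left u α i

theorem tailMap_concat (u : BinVec 8) (α : BinVec 16) : tailMap (concat u α) = α := by
  ext i
  exact Fin.append_right u α i

theorem wt_add_one {n : ℕ} (x : BinVec n) : wt (x + 1) + wt x = n := by
  have h := wt_add x 1
  have h1 : wt (1 : BinVec n) = n := by
    have : (1 : ZMod 2).val = 1 := rfl
    simp [wt, this]
  rw [mul_one] at h
  omega

theorem mem_reedSubcode {G : Submodule (ZMod 2) (BinVec 24)} {α : BinVec 16} :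
    α ∈ reedSubcode G ↔ concat 0 α ∈ G := Iff.rfl

section
variable {G : Submodule (ZMod 2) (BinVec 24)}

theorem concat_add_mem {u v : BinVec 8} {α β : BinVec 16} (h : concat u α ∈ G)
    (h' : concat v β ∈ G) : concat (u + v) (α + β) ∈ G := by
  rw [concat_add]
  exact G.add_mem h h'

/-- Words with the same head differ by an element of the Reed-Muller subcode. -/
theorem add_mem_reedSubcode {u : BinVec 8} {α β : BinVec 16} (h : concat u α ∈ G)
    (h' : concat u β ∈ G) : α + β ∈ reedSubcode G := by
  have := concat_add_mem h h'
  rwa [binVec_add_self] at this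

theorem concat_add_reed_mem {u : BinVec 8} {α β : BinVec 16} (h : concat u α ∈ G)
    (h' : β ∈ reedSubcode G) : concat u (α + β) ∈ G := by
  simpa using concat_add_mem h (mem_reedSubcode.1 h')

variable (hG : IsGolayLike G)
include hG

theorem IsGolayLike.dotProduct_eq_zero {x y : BinVec 24} (hx : x ∈ G) (hy : y ∈ G) :
    x ⬝ᵥ y = 0 := by
  rw [← hG.dual_eq] at hx
  exact mem_dualCode.1 hx y hy

theorem IsGolayLike.eq_zero_or_one_of_concat_mem {u : BinVec 8} (h : concat u 0 ∈ G) :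
    u = 0 ∨ u = 1 := by
  have h1 := wt_add_one u
  by_cases h8 : wt u < 8
  · left
    have := hG.eq_zero_of_wt_lt _ h (by rw [wt_concat, wt_zero]; exact h8)
    rw [← headMap_concat u 0, this, map_zero]
  · right
    exact binVec_eq_of_add_eq_zero (wt_eq_zero_iff.1 (by omega))

theorem IsGolayLike.eq_zero_of_mem_reed {α : BinVec 16} (h : α ∈ reedSubcode G)
    (h8 : wt α < 8) : α = 0 := by
  have := hG.eq_zero_of_wt_lt _ h (by rw [wt_concat, wt_zero]; omega)
  rw [← tailMap_concat 0 α, this, map_zero]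

/-- The head of a codeword is determined by the tail up to complementation. -/
theorem IsGolayLike.head_unique {u v : BinVec 8} {α : BinVec 16} (h : concat u α ∈ G)
    (h' : concat v α ∈ G) : u + v = 0 ∨ u + v = 1 := by
  have := concat_add_mem h h'
  rw [binVec_add_self] at this
  exact hG.eq_zero_or_one_of_concat_mem this

variable (h1 : concat 1 0 ∈ G)
include h1

omit hG in
theorem concat_add_one_mem {u : BinVec 8} {α : BinVec 16} (h : concat u α ∈ G) :
    concat (u + 1) α ∈ G := by
  simpa using concat_add_mem h h1

theorem IsGolayLike.even_head {u : BinVec 8} {α : BinVec 16} (h : concat u α ∈ G) :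
    2 ∣ wt u := by
  have := hG.dotProduct_eq_zero h h1
  rw [two_dvd_wt_iff]
  simpa [concat_dotProduct] using this

omit h1 in
/-- Every vector of even weight is the head of a codeword. -/
theorem IsGolayLike.exists_tail {u : BinVec 8} (hu : 2 ∣ wt u) : ∃ α, concat u α ∈ G := by
  suffices h : u ∈ G.map headMap by
    obtain ⟨x, hx, rfl⟩ := h
    exact ⟨tailMap x, by rwa [concat_head_tail]⟩
  apply mem_of_orthogonal_dualCode
  intro y hy
  have hy0 : concat y 0 ∈ G := by
    rw [← hG.dual_eq, mem_dualCode]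
    intro x hx
    rw [← concat_head_tail x, concat_dotProduct, zero_dotProduct, add_zero]
    exact mem_dualCode.1 hy _ (Submodule.mem_map_of_mem hx)
  rcases hG.eq_zero_or_one_of_concat_mem hy0 with rfl | rfl
  · simp
  · rw [dotProduct_comm]
    exact (two_dvd_wt_iff u).1 hu

omit h1 in
theorem IsGolayLike.tail_mem_dualCode {u : BinVec 8} {α : BinVec 16} (h : concat u α ∈ G) :
    α ∈ dualCode (reedSubcode G) := by
  rw [mem_dualCode]
  intro β hβ
  have := hG.dotProduct_eq_zero h hβ
  simpa [concat_dotProduct] using this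

omit h1 in
/-- The tails of the codewords make up the dual of the Reed-Muller subcode. -/
theorem IsGolayLike.dualCode_reedSubcode : dualCode (reedSubcode G) = G.map tailMap := by
  apply le_antisymm
  · intro α hα
    apply mem_of_orthogonal_dualCode
    intro y hy
    have hy0 : concat 0 y ∈ G := by
      rw [← hG.dual_eq, mem_dualCode]
      intro x hx
      rw [← concat_head_tail x, concat_dotProduct, zero_dotProduct, zero_add]
      exact mem_dualCode.1 hy _ (Submodule.mem_map_of_mem hx)
    rw [dotProduct_comm]
    exact mem_dualCode.1 hα y hy0
  · rintro _ ⟨x, hx, rfl⟩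
    apply hG.tail_mem_dualCode (u := headMap x)
    rwa [concat_head_tail]

omit h1 in
theorem IsGolayLike.exists_head {α : BinVec 16} (hα : α ∈ dualCode (reedSubcode G)) :
    ∃ u, concat u α ∈ G := by
  rw [hG.dualCode_reedSubcode] at hα
  obtain ⟨x, hx, rfl⟩ := hα
  exact ⟨headMap x, by rwa [concat_head_tail]⟩

omit h1 in
theorem IsGolayLike.finrank_eq : Module.finrank (ZMod 2) G = 12 := by
  have h := finrank_add_finrank_dualCode G
  rw [hG.dual_eq] at h
  omega

/-- The tails have dimension `12 - 1`, as only the all-one head occurs with tail zero; hence their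
dual has dimension `5`. -/
theorem IsGolayLike.finrank_reedSubcode : Module.finrank (ZMod 2) (reedSubcode G) = 5 := by
  have h2 := finrank_add_finrank_dualCode (reedSubcode G)
  have h3 := LinearMap.finrank_range_add_finrank_ker (tailMap.domRestrict G)
  have h4 : Module.finrank (ZMod 2) (LinearMap.ker (tailMap.domRestrict G)) = 1 := by
    have hne : concat 1 0 ≠ 0 := by
      intro h
      have := congrArg headMap h
      rw [headMap_concat, map_zero] at this
      exact one_ne_zero this
    refine finrank_eq_one_iff'.2 ⟨⟨⟨concat 1 0, h1⟩, tailMap_concat 1 0⟩, ?_, ?_⟩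
    · intro h
      exact hne (congrArg Subtype.val (congrArg Subtype.val h))
    · rintro ⟨⟨x, hx⟩, hx0⟩
      have hx0 : tailMap x = 0 := hx0
      rw [← concat_head_tail x, hx0] at hx
      rcases hG.eq_zero_or_one_of_concat_mem hx with h | h
      · refine ⟨0, Subtype.ext (Subtype.ext ?_)⟩
        change (0 : ZMod 2) • concat 1 0 = x
        rw [← concat_head_tail x, hx0, h, concat_zero, zero_smul]
      · refine ⟨1, Subtype.ext (Subtype.ext ?_)⟩
        change (1 : ZMod 2) • concat 1 0 = x
        rw [← concat_head_tail x, hx0, h, one_smul]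
  rw [LinearMap.range_domRestrict, ← hG.dualCode_reedSubcode, h4, hG.finrank_eq] at h3
  omega

theorem IsGolayLike.one_mem_reedSubcode : (1 : BinVec 16) ∈ reedSubcode G := by
  rw [mem_reedSubcode, ← hG.dual_eq, mem_dualCode]
  intro x hx
  have h4 := hG.four_dvd x hx
  have h2 := hG.even_head h1 (α := tailMap x) (u := headMap x) (by rwa [concat_head_tail])
  rw [← concat_head_tail x, wt_concat] at h4
  rw [← concat_head_tail x, concat_dotProduct, zero_dotProduct, zero_add, dotProduct_comm,
    ← two_dvd_wt_iff]
  omega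

/-- The coordinates are separated by the Reed-Muller subcode: a word `{i, j}` of its dual would
be the tail of a codeword of weight at most `6`. -/
theorem IsGolayLike.eq_of_forall_reed {i j : Fin 16} (h : ∀ r ∈ reedSubcode G, r i = r j) :
    i = j := by
  by_contra hij
  have hα : (Pi.single i 1 + Pi.single j 1 : BinVec 16) ∈ dualCode (reedSubcode G) := by
    rw [mem_dualCode]
    intro r hr
    rw [add_dotProduct, single_one_dotProduct, single_one_dotProduct, h r hr]
    exact CharTwo.add_self_eq_zero _
  obtain ⟨u, hu⟩ := hG.exists_head hα
  have hwt := wt_add (Pi.single i 1 : BinVec 16) (Pi.single j 1)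
  rw [wt_single, wt_single] at hwt
  have key : ∀ v : BinVec 8, concat v (Pi.single i 1 + Pi.single j 1) ∈ G → ¬ wt v < 6 := by
    intro v hv hlt
    have h0 := hG.eq_zero_of_wt_lt _ hv (by rw [wt_concat]; omega)
    have h0 := congrFun (congrArg tailMap h0) i
    rw [tailMap_concat, map_zero] at h0
    simp [hij] at h0
  have h3 := key _ hu
  have h4 := key _ (concat_add_one_mem h1 hu)
  have := wt_add_one u
  omega
end

/-! ### The labelling of the coordinates by the points of `F_2^4` -/

/-- A labelling of the coordinates for which the code consists of the value vectors of the affine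
functions. -/
def IsAffineLabelling (R : Submodule (ZMod 2) (BinVec 16)) (e : Fin 16 ≃ (Fin 4 → ZMod 2)) :
    Prop :=
  ∀ α : BinVec 16, α ∈ R ↔ ∃ (a : Fin 4 → ZMod 2) (b : ZMod 2), ∀ i, α i = ∑ k, a k * e i k + b

/-- A `5`-dimensional code of length `16` that contains the all-one vector and separates the
coordinates is the first order Reed-Muller code: a basis of the words vanishing at the first
coordinate supplies the labelling. -/
theorem isReedMullerOneFour_of_separates {R : Submodule (ZMod 2) (BinVec 16)}
    (h5 : Module.finrank (ZMod 2) R = 5) (hone : (1 : BinVec 16) ∈ R)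
    (hsep : ∀ i j, (∀ r ∈ R, r i = r j) → i = j) : IsReedMullerOneFour R := by
  set ev : R →ₗ[ZMod 2] ZMod 2 := (LinearMap.proj 0).domRestrict R with hev
  have hsurj : LinearMap.range ev = ⊤ := by
    rw [LinearMap.range_eq_top]
    intro c
    exact ⟨c • ⟨1, hone⟩, by simp [hev]⟩
  have h4 : Module.finrank (ZMod 2) (LinearMap.ker ev) = 4 := by
    have h := LinearMap.finrank_range_add_finrank_ker ev
    rw [hsurj, finrank_top, Module.finrank_self] at h
    omega
  let b := Module.finBasisOfFinrankEq (ZMod 2) (LinearMap.ker ev) h4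
  -- A word is a combination of the basis plus its constant value at the first coordinate.
  have hdecomp : ∀ r (hr : r ∈ R), ∃ a : Fin 4 → ZMod 2,
      ∀ i, r i = ∑ k, a k * (b k : R).1 i + r 0 := by
    intro r hr
    have hker : (⟨r, hr⟩ : R) - r 0 • ⟨1, hone⟩ ∈ LinearMap.ker ev := by
      simp [hev, LinearMap.mem_ker]
    refine ⟨b.repr ⟨_, hker⟩, fun i => ?_⟩
    have h := b.sum_repr ⟨_, hker⟩
    have h := congrFun (congrArg (fun x : LinearMap.ker ev => (x : R).1) h) i
    simp only [AddSubmonoidClass.coe_finsetSum, Finset.sum_apply, SetLike.val_smul,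
      Pi.smul_apply, smul_eq_mul, AddSubgroupClass.coe_sub, Pi.sub_apply, Pi.one_apply,
      mul_one] at h
    rw [h]
    ring
  let f : Fin 16 → (Fin 4 → ZMod 2) := fun i k => (b k : R).1 i
  have hf : Function.Injective f := by
    intro i j hij
    apply hsep
    intro r hr
    obtain ⟨a, ha⟩ := hdecomp r hr
    rw [ha i, ha j]
    congr 1
    exact Finset.sum_congr rfl fun k _ => congrArg (a k * ·) (congrFun hij k)
  have hbij : Function.Bijective f := by
    rw [Fintype.bijective_iff_injective_and_card]
    exact ⟨hf, by simp⟩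
  refine ⟨Equiv.ofBijective f hbij, fun α => ⟨fun hα => ?_, ?_⟩⟩
  · obtain ⟨a, ha⟩ := hdecomp α hα
    exact ⟨a, α 0, ha⟩
  · rintro ⟨a, c, ha⟩
    have : α = ∑ k, a k • (b k : R).1 + c • 1 := by
      ext i
      rw [ha i]
      simp [f]
    rw [this]
    exact R.add_mem (R.sum_mem fun k _ => R.smul_mem _ (b k : R).2) (R.smul_mem _ hone)

theorem IsGolayLike.isReedMullerOneFour {G : Submodule (ZMod 2) (BinVec 24)} (hG : IsGolayLike G)
    (h1 : concat 1 0 ∈ G) : IsReedMullerOneFour (reedSubcode G) :=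
  isReedMullerOneFour_of_separates (hG.finrank_reedSubcode h1) (hG.one_mem_reedSubcode h1)
    fun _ _ => hG.eq_of_forall_reed h1

/-! ### The kernel of the action on coordinates -/

theorem headVec_eq (j : Fin 8) : headVec j = Pi.single j 1 + Pi.single 7 1 := by
  revert j
  unfold headVec
  decide

theorem mem_nordstromRobinson {G : Submodule (ZMod 2) (BinVec 24)} {α : BinVec 16} :
    α ∈ nordstromRobinson G ↔ ∃ i, concat (headVec i) α ∈ G := Iff.rfl

theorem headVec_seven : headVec 7 = 0 := by
  rw [headVec_eq, binVec_add_self]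

theorem reedSubcode_subset {G : Submodule (ZMod 2) (BinVec 24)} :
    (reedSubcode G : Set (BinVec 16)) ⊆ nordstromRobinson G := by
  intro α hα
  exact ⟨7, by rw [headVec_seven]; exact hα⟩

theorem zero_mem_nordstromRobinson {G : Submodule (ZMod 2) (BinVec 24)} :
    (0 : BinVec 16) ∈ nordstromRobinson G := reedSubcode_subset (reedSubcode G).zero_mem

theorem two_dvd_wt_headVec : ∀ j : Fin 8, 2 ∣ wt (headVec j) := by
  unfold headVec wt
  decide

theorem mem_codeAut {m : ℕ} {C : Set (BinVec m)} {x : HammingAut m} :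
    x ∈ codeAut C ↔ (fun α => x α) '' C = C := Iff.rfl

theorem codeAut_apply_mem {m : ℕ} {C : Set (BinVec m)} {x : HammingAut m} (hx : x ∈ codeAut C)
    {α : BinVec m} (hα : α ∈ C) : x α ∈ C := by
  rw [← mem_codeAut.1 hx]
  exact ⟨α, hα, rfl⟩

/-- As codes are finite, an automorphism mapping a code into itself stabilises it. -/
theorem mem_codeAut_of_forall {m : ℕ} {C : Set (BinVec m)} {x : HammingAut m}
    (h : ∀ α ∈ C, x α ∈ C) : x ∈ codeAut C := by
  rw [mem_codeAut]
  apply Set.eq_of_subset_of_ncard_le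
  · rintro _ ⟨α, hα, rfl⟩
    exact h α hα
  · rw [Set.ncard_image_of_injective _ x.injective]
  · exact C.toFinite

theorem coordPermHom_eq {m : ℕ} {x : HammingAut m} {σ : Equiv.Perm (Fin m)}
    (h : ∀ α i, x α (σ i) = α i + x 0 (σ i)) : coordPermHom m x = σ :=
  coordPerm_unique x _ _ (coordPermHom_spec x) h

theorem apply_eq {m : ℕ} (x : HammingAut m) (α : BinVec m) :
    x α = α ∘ (coordPermHom m x).symm + x 0 := by
  ext i
  simpa using coordPermHom_spec x α ((coordPermHom m x).symm i)

theorem translationHom_apply {m : ℕ} (β α : BinVec m) :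
    translationHom m (.ofAdd β) α = α + β := rfl

theorem coordPermHom_eq_one_iff {m : ℕ} {x : HammingAut m} :
    coordPermHom m x = 1 ↔ x = translationHom m (.ofAdd (x 0)) := by
  constructor
  · intro h
    apply RelIso.ext
    intro α
    rw [apply_eq, h, translationHom_apply]
    rfl
  · intro h
    rw [h]
    exact coordPermHom_eq fun α i => by simp [translationHom_apply]

theorem translationHom_injective (m : ℕ) : Function.Injective (translationHom m) := by
  intro β γ h
  have := congrArg (fun x : HammingAut m => x 0) h
  change (0 : BinVec m) + β.toAdd = 0 + γ.toAdd at this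
  simpa using this

section
variable {G : Submodule (ZMod 2) (BinVec 24)}

theorem translation_mem_codeAut {β : BinVec 16} (hβ : β ∈ reedSubcode G) :
    translationHom 16 (.ofAdd β) ∈ codeAut (nordstromRobinson G) := by
  apply mem_codeAut_of_forall
  rintro α ⟨i, hi⟩
  exact ⟨i, concat_add_reed_mem hi hβ⟩

/-- The sum of two different head vectors is no head vector, even up to complementation, unless
one of the two is zero. -/
theorem headVec_add_ne : ∀ i j : Fin 8, i ≠ 7 → j ≠ 7 → j ≠ i → ∀ k : Fin 8,
    headVec i + headVec j + headVec k ≠ 0 ∧ headVec i + headVec j + headVec k ≠ 1 := by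
  unfold headVec
  decide +kernel

/-- The translations that preserve the Nordstrom-Robinson code are those by the Reed-Muller
subcode: a word with head `{i, 8}` takes the words with head `{j, 8}` to words with head
`{i, j}`. -/
theorem IsGolayLike.mem_reed_of_translation_mem (hG : IsGolayLike G)
    {β : BinVec 16} (hβ : translationHom 16 (.ofAdd β) ∈ codeAut (nordstromRobinson G)) :
    β ∈ reedSubcode G := by
  obtain ⟨i, hi⟩ := codeAut_apply_mem hβ zero_mem_nordstromRobinson
  rw [translationHom_apply, zero_add] at hi
  by_cases h7 : i = 7
  · rwa [h7, headVec_seven] at hi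
  · obtain ⟨j, hj7, hji⟩ := (by decide : ∀ i : Fin 8, ∃ j : Fin 8, j ≠ 7 ∧ j ≠ i) i
    obtain ⟨α, hα⟩ := hG.exists_tail (two_dvd_wt_headVec j)
    obtain ⟨k, hk⟩ := codeAut_apply_mem hβ (mem_nordstromRobinson.2 ⟨j, hα⟩)
    rw [translationHom_apply, add_comm] at hk
    have h := headVec_add_ne i j h7 hj7 hji k
    rcases hG.head_unique (concat_add_mem hi hα) hk with h' | h'
    · exact absurd h' h.1
    · exact absurd h' h.2

theorem IsGolayLike.map_ker_codeCoordAction (hG : IsGolayLike G) :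
    (codeCoordAction (nordstromRobinson G)).ker.map (codeAut (nordstromRobinson G)).subtype
      = translationGroup (reedSubcode G) := by
  ext x
  constructor
  · rintro ⟨⟨x, hx⟩, hker, rfl⟩
    have h := coordPermHom_eq_one_iff.1 (show coordPermHom 16 x = 1 from hker)
    refine ⟨.ofAdd (x 0), ?_, h.symm⟩
    exact hG.mem_reed_of_translation_mem (h ▸ hx)
  · rintro ⟨β, hβ, rfl⟩
    have hβ : β.toAdd ∈ reedSubcode G := hβ
    refine ⟨⟨_, translation_mem_codeAut hβ⟩, ?_, rfl⟩
    have h0 : translationHom 16 β 0 = β.toAdd := zero_add _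
    exact coordPermHom_eq_one_iff.2 (congrArg (fun γ => translationHom 16 (.ofAdd γ)) h0).symm

theorem IsGolayLike.card_ker_codeCoordAction (hG : IsGolayLike G) (h1 : concat 1 0 ∈ G) :
    Nat.card (codeCoordAction (nordstromRobinson G)).ker = 2 ^ 5 := by
  rw [← Subgroup.card_map_of_injective (codeAut (nordstromRobinson G)).subtype_injective,
    hG.map_ker_codeCoordAction, translationGroup,
    Subgroup.card_map_of_injective (translationHom_injective 16)]
  have h := Module.natCard_eq_pow_finrank (K := ZMod 2) (V := reedSubcode G)
  rw [hG.finrank_reedSubcode h1, Nat.card_zmod] at h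
  exact h

/-- As the kernel is normal, coordinate permutations induced by automorphisms preserve the
Reed-Muller subcode. -/
theorem IsGolayLike.comp_symm_mem_reed (hG : IsGolayLike G) {x : HammingAut 16}
    (hx : x ∈ codeAut (nordstromRobinson G)) {α : BinVec 16} (hα : α ∈ reedSubcode G) :
    α ∘ (coordPermHom 16 x).symm ∈ reedSubcode G := by
  apply hG.mem_reed_of_translation_mem
  convert mul_mem (mul_mem hx (translation_mem_codeAut hα)) (inv_mem hx) using 1
  apply RelIso.ext
  intro β
  change _ = x (x.symm β + α)
  have h1 := apply_eq x (x.symm β + α)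
  have h2 := apply_eq x (x.symm β)
  rw [RelIso.apply_symm_apply] at h2
  rw [translationHom_apply, h1]
  conv_lhs => rw [h2]
  ext i
  simp only [Pi.add_apply, Function.comp_apply]
  ring

end

/-! ### Stars among the vectors of weight two -/

theorem zmod_two_eq_one {a : ZMod 2} (h : a ≠ 0) : a = 1 := by
  revert a
  decide

theorem mul_single_eq {n : ℕ} {x : BinVec n} {c : Fin n} (h : x c = 1) :
    x * Pi.single c 1 = Pi.single c 1 := by
  ext i
  by_cases hi : i = c
  · subst hi
    simp [h]
  · simp [hi]

theorem exists_eq_single_of_wt {n : ℕ} {x : BinVec n} (h : wt x = 1) :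
    ∃ t, x = Pi.single t 1 := by
  rw [wt_eq_card, Finset.card_eq_one] at h
  obtain ⟨t, ht⟩ := h
  refine ⟨t, ?_⟩
  rw [binVec_eq_sum_single x, ht, Finset.sum_singleton]

theorem exists_add_single_eq {n : ℕ} {x : BinVec n} {c : Fin n} (h : wt x = 2) (hc : x c = 1) :
    ∃ t, x + Pi.single c 1 = Pi.single t 1 := by
  apply exists_eq_single_of_wt
  have := wt_add x (Pi.single c 1)
  rw [mul_single_eq hc, wt_single] at this
  omega

theorem single_injective {n : ℕ} {i j : Fin n}
    (h : (Pi.single i 1 : BinVec n) = Pi.single j 1) : i = j := by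
  by_contra hne
  have := congrFun h i
  simp [hne] at this

/-- Pairwise intersecting vectors of weight two without triangles form a star. -/
theorem exists_perm_of_star {w : Fin 8 → BinVec 8} (h7 : w 7 = 0)
    (h2 : ∀ i j, i ≠ j → wt (w i + w j) = 2)
    (h3 : ∀ i j k, i ≠ 7 → j ≠ 7 → k ≠ 7 → i ≠ j → i ≠ k → j ≠ k → w i + w j + w k ≠ 0) :
    ∃ τ : Equiv.Perm (Fin 8), ∀ j, w j = Pi.single (τ j) 1 + Pi.single (τ 7) 1 := by
  have hw : ∀ i, i ≠ 7 → wt (w i) = 2 := fun i hi => by simpa [h7] using h2 i 7 hi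
  have hmul : ∀ i j, i ≠ 7 → j ≠ 7 → i ≠ j → wt (w i * w j) = 1 := by
    intro i j hi hj hij
    have := wt_add (w i) (w j)
    rw [h2 i j hij, hw i hi, hw j hj] at this
    omega
  have hdot : ∀ i j, i ≠ 7 → j ≠ 7 → i ≠ j → w i ⬝ᵥ w j = 1 := by
    intro i j hi hj hij
    apply zmod_two_eq_one
    rw [Ne, ← two_dvd_wt_mul_iff, hmul i j hi hj hij]
    decide
  obtain ⟨c, hc⟩ : ∃ c, (w 0 * w 1) c ≠ 0 := by
    by_contra! h
    have h0 : w 0 * w 1 = 0 := funext h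
    have := hmul 0 1 (by decide) (by decide) (by decide)
    simp [h0] at this
  have hc0 : w 0 c = 1 := zmod_two_eq_one (left_ne_zero_of_mul hc)
  have hc1 : w 1 c = 1 := zmod_two_eq_one (right_ne_zero_of_mul hc)
  obtain ⟨a, ha⟩ := exists_add_single_eq (hw 0 (by decide)) hc0
  obtain ⟨b, hb⟩ := exists_add_single_eq (hw 1 (by decide)) hc1
  have ha' : w 0 = Pi.single a 1 + Pi.single c 1 := by
    rw [← ha, add_assoc, binVec_add_self, add_zero]
  have hb' : w 1 = Pi.single b 1 + Pi.single c 1 := by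
    rw [← hb, add_assoc, binVec_add_self, add_zero]
  have hcj : ∀ j, j ≠ 7 → w j c = 1 := by
    intro j hj
    by_cases hj0 : j = 0
    · rw [hj0, hc0]
    by_cases hj1 : j = 1
    · rw [hj1, hc1]
    by_contra hne
    have hne : w j c = 0 := by
      by_contra h
      exact hne (zmod_two_eq_one h)
    -- A vector meeting both `w 0` and `w 1` outside `c` completes them to a triangle.
    have hja := hdot 0 j (by decide) hj (Ne.symm hj0)
    have hjb := hdot 1 j (by decide) hj (Ne.symm hj1)
    rw [ha', add_dotProduct, single_one_dotProduct, single_one_dotProduct, hne, add_zero] at hja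
    rw [hb', add_dotProduct, single_one_dotProduct, single_one_dotProduct, hne, add_zero] at hjb
    obtain ⟨t, ht⟩ := exists_add_single_eq (hw j hj) hja
    have hab : b ≠ a := by
      rintro rfl
      have := h2 0 1 (by decide)
      rw [ha', hb', binVec_add_self, wt_zero] at this
      omega
    have htb : b = t := by
      by_contra hbt
      have := congrFun ht b
      simp [hjb, hab, hbt] at this
    refine h3 0 1 j (by decide) (by decide) hj (by decide) (Ne.symm hj0) (Ne.symm hj1) ?_
    have hwj : w j = Pi.single b 1 + Pi.single a 1 := by
      rw [htb, ← ht, add_assoc, binVec_add_self, add_zero]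
    have hsum : w 0 + w 1 = w j := by
      rw [ha', hb', hwj, add_add_add_comm, binVec_add_self, add_zero, add_comm]
    rw [hsum, binVec_add_self]
  have hex : ∀ j, ∃ t, w j + Pi.single c 1 = Pi.single t 1 := by
    intro j
    by_cases hj : j = 7
    · exact ⟨c, by rw [hj, h7, zero_add]⟩
    · exact exists_add_single_eq (hw j hj) (hcj j hj)
  choose t ht using hex
  have hw' : ∀ j, w j = Pi.single (t j) 1 + Pi.single c 1 := by
    intro j
    rw [← ht, add_assoc, binVec_add_self, add_zero]
  have htinj : Function.Injective t := by
    intro i j hij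
    by_contra hne
    have := h2 i j hne
    rw [hw', hw', hij, binVec_add_self, wt_zero] at this
    omega
  have hct : c = t 7 := by
    have := ht 7
    rw [h7, zero_add] at this
    exact single_injective this
  refine ⟨Equiv.ofBijective t (Finite.injective_iff_bijective.mp htinj), fun j => ?_⟩
  rw [Equiv.ofBijective_apply, Equiv.ofBijective_apply, ← hct]
  exact hw' j

/-! ### Lifting coordinate permutations to automorphisms of the Golay code -/

/-- The permutations `τ` of the first `8` and `σ` of the last `16` coordinates together preserve
the code `G`. -/
def PreservesPair (G : Submodule (ZMod 2) (BinVec 24)) (τ : Equiv.Perm (Fin 8))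
    (σ : Equiv.Perm (Fin 16)) : Prop :=
  ∀ u α, concat u α ∈ G → concat (u ∘ τ.symm) (α ∘ σ.symm) ∈ G

theorem PreservesPair.mul {G : Submodule (ZMod 2) (BinVec 24)} {τ τ' : Equiv.Perm (Fin 8)}
    {σ σ' : Equiv.Perm (Fin 16)} (h : PreservesPair G τ σ) (h' : PreservesPair G τ' σ') :
    PreservesPair G (τ * τ') (σ * σ') :=
  fun u α hu => h _ _ (h' u α hu)

theorem single_comp_symm {n : ℕ} (τ : Equiv.Perm (Fin n)) (i : Fin n) :
    (Pi.single i 1 : BinVec n) ∘ τ.symm = Pi.single (τ i) 1 := by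
  ext j
  simp [Pi.single_apply, Equiv.symm_apply_eq]

theorem add_comp {m n : ℕ} (x y : BinVec m) (f : Fin n → Fin m) :
    (x + y) ∘ f = x ∘ f + y ∘ f := rfl

theorem wt_single_add_single {n : ℕ} {i j : Fin n} (h : i ≠ j) :
    wt (Pi.single i 1 + Pi.single j 1 : BinVec n) = 2 := by
  have h1 := wt_add (Pi.single i 1 : BinVec n) (Pi.single j 1)
  have h2 : (Pi.single i 1 : BinVec n) * Pi.single j 1 = 0 := by
    ext k
    by_cases hk : k = i
    · subst hk
      simp [h]
    · simp [hk]
  rw [h2, wt_single, wt_single, wt_zero] at h1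
  omega

theorem wt_one_eight : wt (1 : BinVec 8) = 8 := by
  unfold wt
  decide

/-- The action on the first `8` coordinates is determined by the action on the last `16`. -/
theorem IsGolayLike.preservesPair_unique {G : Submodule (ZMod 2) (BinVec 24)}
    (hG : IsGolayLike G) {τ τ' : Equiv.Perm (Fin 8)} {σ : Equiv.Perm (Fin 16)}
    (h : PreservesPair G τ σ) (h' : PreservesPair G τ' σ) : τ = τ' := by
  have key : ∀ i j, i ≠ j → τ i = τ' i ∨ τ i = τ' j := by
    intro i j hij
    obtain ⟨α, hα⟩ := hG.exists_tail (u := Pi.single i 1 + Pi.single j 1)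
      (by rw [wt_single_add_single hij])
    have h1 := h _ _ hα
    have h2 := h' _ _ hα
    rw [add_comp, single_comp_symm, single_comp_symm] at h1 h2
    have h0 : (Pi.single (τ i) 1 + Pi.single (τ j) 1 : BinVec 8) +
        (Pi.single (τ' i) 1 + Pi.single (τ' j) 1) = 0 := by
      refine (hG.head_unique h1 h2).resolve_right fun hone => ?_
      have hwt := wt_add (Pi.single (τ i) 1 + Pi.single (τ j) 1 : BinVec 8)
        (Pi.single (τ' i) 1 + Pi.single (τ' j) 1)
      rw [hone, wt_one_eight, wt_single_add_single (τ.injective.ne hij),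
        wt_single_add_single (τ'.injective.ne hij)] at hwt
      omega
    by_contra! hne
    have := congrFun h0 (τ i)
    simp [hne.1, hne.2, hij] at this
  ext1 i
  obtain ⟨j, k, hj, hk, hjk⟩ :=
    (by decide : ∀ i : Fin 8, ∃ j k : Fin 8, i ≠ j ∧ i ≠ k ∧ j ≠ k) i
  rcases key i j hj with h | hij
  · exact h
  · rcases key i k hk with h | hik
    · exact h
    · exact absurd (τ'.injective (hij.symm.trans hik)) hjk

/-- The `headVec j` span the vectors of even weight. -/
theorem sum_headVec {u : BinVec 8} (hu : 2 ∣ wt u) : u = ∑ j, u j • headVec j := by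
  have h0 : ∑ j, u j = 0 := by
    rw [← wt_cast]
    exact (ZMod.natCast_eq_zero_iff _ _).2 hu
  simp only [headVec_eq, smul_add, Finset.sum_add_distrib]
  rw [← Finset.sum_smul, h0, zero_smul, add_zero]
  ext i
  simp [Finset.sum_apply, Pi.single_apply]

/-- The words with head `headVec j`, one for each `j`, generate the Golay code together with the
Reed-Muller subcode, so that it suffices to check these. -/
theorem preservesPair_of_headVec {G : Submodule (ZMod 2) (BinVec 24)} (hG : IsGolayLike G)
    (h1 : concat 1 0 ∈ G) {τ : Equiv.Perm (Fin 8)} {σ : Equiv.Perm (Fin 16)}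
    {β : Fin 8 → BinVec 16} (hβ : ∀ j, concat (headVec j) (β j) ∈ G)
    (hβσ : ∀ j, concat (headVec j ∘ τ.symm) (β j ∘ σ.symm) ∈ G)
    (hσ : ∀ r ∈ reedSubcode G, r ∘ σ.symm ∈ reedSubcode G) : PreservesPair G τ σ := by
  intro u α hu
  have hsum := sum_headVec (hG.even_head h1 hu)
  have hsmul : ∀ (c : ZMod 2) (v : BinVec 8) (γ : BinVec 16), concat v γ ∈ G →
      concat (c • v) (c • γ) ∈ G := by
    intro c v γ hv
    have : ∀ c : ZMod 2, c = 0 ∨ c = 1 := by decide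
    rcases this c with rfl | rfl
    · simp only [zero_smul, concat_zero, zero_mem]
    · simpa using hv
  have hmem : ∀ (s : Finset (Fin 8)) (v : Fin 8 → BinVec 8) (γ : Fin 8 → BinVec 16),
      (∀ j, concat (v j) (γ j) ∈ G) →
      concat (∑ j ∈ s, u j • v j) (∑ j ∈ s, u j • γ j) ∈ G := by
    intro s v γ h
    induction s using Finset.induction_on with
    | empty => simp [concat_zero]
    | insert a s ha ih =>
      rw [Finset.sum_insert ha, Finset.sum_insert ha]
      exact concat_add_mem (hsmul _ _ _ (h a)) ih
  have hβu := hmem Finset.univ _ _ hβ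
  rw [← hsum] at hβu
  have hr := hσ _ (add_mem_reedSubcode hβu hu)
  have h := concat_add_reed_mem (hmem Finset.univ _ _ hβσ) hr
  convert h using 2
  · conv_lhs => rw [hsum]
    ext i
    simp [Finset.sum_apply]
  · rw [add_comp]
    have : (∑ j, u j • β j) ∘ σ.symm = ∑ j, u j • β j ∘ σ.symm := by
      ext i
      simp [Finset.sum_apply]
    rw [this, binVec_add_add_cancel]

/-- Every permutation of the last `16` coordinates that preserves the Reed-Muller subcode extends
to an automorphism of the Golay code fixing the octad of the first `8` coordinates: it permutes
the heads of weight two modulo complementation, and the star of the `headVec j` is taken to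
another star. -/
theorem IsGolayLike.exists_preservesPair {G : Submodule (ZMod 2) (BinVec 24)}
    (hG : IsGolayLike G) (h1 : concat 1 0 ∈ G) {σ : Equiv.Perm (Fin 16)}
    (hσ : ∀ r, r ∘ σ.symm ∈ reedSubcode G ↔ r ∈ reedSubcode G) : ∃ τ, PreservesPair G τ σ := by
  choose β hβ using fun j => hG.exists_tail (two_dvd_wt_headVec j)
  have hdual : ∀ α ∈ dualCode (reedSubcode G), α ∘ σ.symm ∈ dualCode (reedSubcode G) := by
    intro α hα
    rw [mem_dualCode] at hα ⊢
    intro r hr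
    have hr' : r ∘ σ ∈ reedSubcode G := by
      rw [← hσ]
      convert hr using 1
      ext i
      simp
    rw [← hα _ hr', dotProduct_comm, dotProduct_comp_equiv_symm, dotProduct_comm]
  have hwtcomp : ∀ α : BinVec 16, wt (α ∘ σ.symm) = wt α := fun α => wt_comp α σ.symm
  have hfour : ∀ {u : BinVec 8} {α : BinVec 16}, concat u α ∈ G → 4 ∣ wt u + wt α := by
    intro u α h
    rw [← wt_concat]
    exact hG.four_dvd _ h
  have hwthead : ∀ j, j ≠ 7 → wt (headVec j) = 2 := by
    intro j hj
    rw [headVec_eq, wt_single_add_single hj]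
  have hex : ∀ j, ∃ w : BinVec 8, (j = 7 → w = 0) ∧ (j ≠ 7 → wt w = 2) ∧
      concat w (β j ∘ σ.symm) ∈ G := by
    intro j
    by_cases hj : j = 7
    · refine ⟨0, fun _ => rfl, fun h => absurd hj h, ?_⟩
      have := hβ j
      rw [hj, headVec_seven] at this
      rw [hj]
      exact (hσ _).2 this
    · obtain ⟨u, hu⟩ := hG.exists_head (hdual _ (hG.tail_mem_dualCode (hβ j)))
      have h4 := hfour hu
      have h4' := hfour (hβ j)
      rw [hwtcomp] at h4
      rw [hwthead j hj] at h4'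
      have hle := wt_add_one u
      by_cases h2 : wt u = 2
      · exact ⟨u, fun h => absurd h hj, fun _ => h2, hu⟩
      · exact ⟨u + 1, fun h => absurd h hj, fun _ => by omega, concat_add_one_mem h1 hu⟩
  choose w hw7 hw2 hw using hex
  have h2 : ∀ i j, i ≠ j → wt (w i + w j) = 2 := by
    intro i j hij
    have ha := hfour (concat_add_mem (hw i) (hw j))
    have hb := hfour (concat_add_mem (hβ i) (hβ j))
    rw [← add_comp, hwtcomp] at ha
    have hc : headVec i + headVec j = Pi.single i 1 + Pi.single j 1 := by
      rw [headVec_eq, headVec_eq, add_add_add_comm, binVec_add_self, add_zero]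
    rw [hc, wt_single_add_single hij] at hb
    have hd := wt_add (w i) (w j)
    have he : ∀ j, wt (w j) ≤ 2 := by
      intro j
      by_cases hj : j = 7
      · rw [hw7 j hj, wt_zero]
        omega
      · rw [hw2 j hj]
    have := he i
    have := he j
    omega
  have h3 : ∀ i j k, i ≠ 7 → j ≠ 7 → k ≠ 7 → i ≠ j → i ≠ k → j ≠ k →
      w i + w j + w k ≠ 0 := by
    intro i j k hi hj hk hij hik hjk h0
    have ha := concat_add_mem (concat_add_mem (hw i) (hw j)) (hw k)
    have hb := concat_add_mem (concat_add_mem (hβ i) (hβ j)) (hβ k)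
    rw [h0, ← add_comp, ← add_comp] at ha
    rcases hG.head_unique hb ((hσ _).1 ha) with h | h
    · rw [add_zero] at h
      exact (headVec_add_ne i j hi hj (Ne.symm hij) k).1 h
    · rw [add_zero] at h
      exact (headVec_add_ne i j hi hj (Ne.symm hij) k).2 h
  obtain ⟨τ, hτ⟩ := exists_perm_of_star (hw7 7 rfl) h2 h3
  refine ⟨τ, preservesPair_of_headVec hG h1 hβ (fun j => ?_) fun r hr => (hσ r).2 hr⟩
  rw [headVec_eq, add_comp, single_comp_symm, single_comp_symm, ← hτ]
  exact hw j

/-! ### The image of the action on coordinates -/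

/-- The automorphism of the Hamming graph that permutes the coordinates by `σ`. -/
def permAut {m : ℕ} (σ : Equiv.Perm (Fin m)) : HammingAut m where
  toEquiv := σ.arrowCongr (Equiv.refl _)
  map_rel_iff' := by
    intro α β
    have h : hammingDist (α ∘ σ.symm) (β ∘ σ.symm) = hammingDist α β :=
      Finset.card_equiv σ.symm (by simp)
    change hammingDist (α ∘ σ.symm) (β ∘ σ.symm) = 1 ↔ hammingDist α β = 1
    rw [h]

/-- The permutations of the coordinates induced by automorphisms of the Nordstrom-Robinson code are
those preserving the Reed-Muller subcode. -/
theorem IsGolayLike.mem_range_codeCoordAction {G : Submodule (ZMod 2) (BinVec 24)}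
    (hG : IsGolayLike G) (h1 : concat 1 0 ∈ G) (σ : Equiv.Perm (Fin 16)) :
    σ ∈ (codeCoordAction (nordstromRobinson G)).range ↔
      ∀ r, r ∘ σ.symm ∈ reedSubcode G ↔ r ∈ reedSubcode G := by
  constructor
  · rintro ⟨⟨x, hx⟩, rfl⟩ r
    change r ∘ (coordPermHom 16 x).symm ∈ _ ↔ _
    refine ⟨fun h => ?_, hG.comp_symm_mem_reed hx⟩
    have h' := hG.comp_symm_mem_reed (inv_mem hx) h
    rw [map_inv] at h'
    convert h' using 1
    ext i
    exact congrArg r ((coordPermHom 16 x).symm_apply_apply i).symm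
  · intro hσ
    obtain ⟨τ, hτ⟩ := hG.exists_preservesPair h1 hσ
    -- The translation part carries the star at `τ 7` back to the star at `7`.
    obtain ⟨β, hβ⟩ := hG.exists_tail (two_dvd_wt_headVec (τ 7))
    have happly : ∀ α, (translationHom 16 (.ofAdd β) * permAut σ) α = α ∘ σ.symm + β :=
      fun α => rfl
    refine ⟨⟨translationHom 16 (.ofAdd β) * permAut σ, mem_codeAut_of_forall ?_⟩, ?_⟩
    · rintro α ⟨j, hj⟩
      refine ⟨τ j, ?_⟩
      rw [happly]
      convert concat_add_mem (hτ _ _ hj) hβ using 2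
      rw [headVec_eq j, add_comp, single_comp_symm, single_comp_symm, headVec_eq, headVec_eq,
        add_assoc, binVec_add_add_cancel]
    · apply coordPermHom_eq
      intro α i
      change (translationHom 16 (.ofAdd β) * permAut σ) α (σ i) =
        α i + (translationHom 16 (.ofAdd β) * permAut σ) 0 (σ i)
      rw [happly, happly]
      simp

/-! ### Affine permutations of `F_2^4` -/

theorem IsAffineLabelling.mem_iff {R : Submodule (ZMod 2) (BinVec 16)}
    {e : Fin 16 ≃ (Fin 4 → ZMod 2)} (he : IsAffineLabelling R e) {α : BinVec 16} :
    α ∈ R ↔ ∃ (f : (Fin 4 → ZMod 2) →+ ZMod 2) (b : ZMod 2), ∀ i, α i = f (e i) + b := by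
  rw [he]
  constructor
  · rintro ⟨a, b, h⟩
    exact ⟨(dotProductEquiv (ZMod 2) (Fin 4) a).toAddMonoidHom, b, h⟩
  · rintro ⟨f, b, h⟩
    obtain ⟨a, ha⟩ := (dotProductEquiv (ZMod 2) (Fin 4)).surjective (f.toZModLinearMap 2)
    refine ⟨a, b, fun i => ?_⟩
    rw [h i]
    exact congrArg (· + b) (DFunLike.congr_fun ha (e i)).symm

/-- The action of the holomorph of a group on the group; for a vector space over a prime field
these are the affine permutations. -/
def holomorphHom (M : Type*) [Group M] :
    M ⋊[MonoidHom.id (MulAut M)] MulAut M →* Equiv.Perm M where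
  toFun p := p.right.toEquiv.trans (Equiv.mulLeft p.left)
  map_one' := by
    ext x
    simp
  map_mul' p q := by
    ext x
    simp

theorem holomorphHom_injective (M : Type*) [Group M] : Function.Injective (holomorphHom M) := by
  intro p q h
  have h' : ∀ x, p.left * p.right x = q.left * q.right x := fun x => DFunLike.congr_fun h x
  have hl : p.left = q.left := by simpa using h' 1
  refine SemidirectProduct.ext hl (MulEquiv.ext fun x => ?_)
  simpa [hl] using h' x

/-- The permutation of the coordinates belonging to an affine permutation of the labels. -/
def affinePermHom (e : Fin 16 ≃ (Fin 4 → ZMod 2)) :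
    Multiplicative (Fin 4 → ZMod 2) ⋊[MonoidHom.id (MulAut (Multiplicative (Fin 4 → ZMod 2)))]
      MulAut (Multiplicative (Fin 4 → ZMod 2)) →* Equiv.Perm (Fin 16) :=
  ((e.trans Multiplicative.ofAdd).symm.permCongrHom.toMonoidHom).comp (holomorphHom _)

theorem affinePermHom_injective (e : Fin 16 ≃ (Fin 4 → ZMod 2)) :
    Function.Injective (affinePermHom e) :=
  (e.trans Multiplicative.ofAdd).symm.permCongrHom.injective.comp (holomorphHom_injective _)

theorem label_affinePermHom (e : Fin 16 ≃ (Fin 4 → ZMod 2))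
    (p : Multiplicative (Fin 4 → ZMod 2) ⋊[MonoidHom.id
      (MulAut (Multiplicative (Fin 4 → ZMod 2)))] MulAut (Multiplicative (Fin 4 → ZMod 2)))
    (i : Fin 16) :
    e (affinePermHom e p i) = AddEquiv.toMultiplicative.symm p.right (e i) + p.left.toAdd := by
  rw [add_comm]
  exact e.apply_symm_apply _

/-- The permutations of the coordinates that preserve the first order Reed-Muller code are the
affine permutations of the labels. -/
theorem IsAffineLabelling.mem_range_affinePermHom {R : Submodule (ZMod 2) (BinVec 16)}
    {e : Fin 16 ≃ (Fin 4 → ZMod 2)} (he : IsAffineLabelling R e) (σ : Equiv.Perm (Fin 16)) :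
    σ ∈ (affinePermHom e).range ↔ ∀ r, r ∘ σ.symm ∈ R ↔ r ∈ R := by
  constructor
  · have key : ∀ p, ∀ r ∈ R, r ∘ affinePermHom e p ∈ R := by
      intro p r hr
      obtain ⟨f, b, hf⟩ := he.mem_iff.1 hr
      refine he.mem_iff.2 ⟨f.comp (AddEquiv.toMultiplicative.symm p.right).toAddMonoidHom,
        f p.left.toAdd + b, fun i => ?_⟩
      rw [Function.comp_apply, hf, label_affinePermHom, map_add, add_assoc]
      rfl
    rintro ⟨p, rfl⟩ r
    constructor
    · intro h
      convert key p _ h using 1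
      ext i
      simp
    · intro h
      have := key p⁻¹ r h
      rwa [map_inv] at this
  · intro hσ
    have hcoord : ∀ k, ∃ (f : (Fin 4 → ZMod 2) →+ ZMod 2) (b : ZMod 2),
        ∀ i, e (σ i) k = f (e i) + b := by
      intro k
      have h : (fun i => e (σ i) k) ∈ R := by
        rw [← hσ]
        refine he.mem_iff.2 ⟨Pi.evalAddMonoidHom _ k, 0, fun i => ?_⟩
        simp
      exact he.mem_iff.1 h
    choose f b hfb using hcoord
    let g : (Fin 4 → ZMod 2) →+ (Fin 4 → ZMod 2) := AddMonoidHom.pi f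
    have hg : ∀ x, g x = e (σ (e.symm x)) - b := by
      intro x
      ext k
      rw [Pi.sub_apply, hfb, e.apply_symm_apply, add_sub_cancel_right]
      rfl
    have hginj : Function.Injective g := by
      intro x y hxy
      rw [hg, hg] at hxy
      simpa using hxy
    let g' := AddEquiv.ofBijective g (Finite.injective_iff_bijective.mp hginj)
    refine ⟨⟨.ofAdd b, AddEquiv.toMultiplicative g'⟩, ?_⟩
    ext1 i
    apply e.injective
    rw [label_affinePermHom]
    change g (e i) + b = e (σ i)
    rw [hg]
    simp

/-! ### The linear group of `F_2^4` and the alternating group of degree eight -/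

/-- Additive maps over a prime field are linear. -/
def linearEquivEquivAddEquiv (n : ℕ) (V : Type*) [AddCommGroup V] [Module (ZMod n) V] :
    (V ≃ₗ[ZMod n] V) ≃ (V ≃+ V) where
  toFun f := f.toAddEquiv
  invFun g := { g with map_smul' := ZMod.map_smul g }
  left_inv _ := rfl
  right_inv _ := rfl

/-- The order of `GL(4,2)`. -/
theorem card_mulAut_multiplicative :
    Nat.card (MulAut (Multiplicative (Fin 4 → ZMod 2))) = 20160 := by
  have h := Matrix.card_GL_field (𝔽 := ZMod 2) 4
  have e1 : GL (Fin 4) (ZMod 2) ≃ MulAut (Multiplicative (Fin 4 → ZMod 2)) :=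
    (Matrix.GeneralLinearGroup.toLin.toEquiv.trans
      (LinearMap.GeneralLinearGroup.generalLinearEquiv _ _).toEquiv).trans
      ((linearEquivEquivAddEquiv 2 _).trans AddEquiv.toMultiplicative)
  rw [← Nat.card_congr e1, h, ZMod.card, Fin.prod_univ_four]
  rfl

/-- The planes through `0` are words of the dual of the Reed-Muller code. -/
theorem IsAffineLabelling.plane_mem_dualCode {R : Submodule (ZMod 2) (BinVec 16)}
    {e : Fin 16 ≃ (Fin 4 → ZMod 2)} (he : IsAffineLabelling R e) (x y : Fin 4 → ZMod 2) :
    (Pi.single (e.symm 0) 1 + Pi.single (e.symm x) 1 + Pi.single (e.symm y) 1 +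
      Pi.single (e.symm (x + y)) 1 : BinVec 16) ∈ dualCode R := by
  rw [mem_dualCode]
  intro r hr
  obtain ⟨f, b, hf⟩ := he.mem_iff.1 hr
  simp only [add_dotProduct, single_one_dotProduct, hf, Equiv.apply_symm_apply, map_zero, map_add]
  have : ∀ p q b : ZMod 2, 0 + b + (p + b) + (q + b) + (p + q + b) = 0 := by decide
  exact this _ _ _

/-- A linear permutation of the labels that fixes all heads is the identity: it preserves every
plane through `0`, since the sum of a plane and its image is a word of weight at most `6` of the
Reed-Muller subcode, and the planes through a line meet in this line. -/
theorem IsGolayLike.eq_self_of_preservesPair_one {G : Submodule (ZMod 2) (BinVec 24)}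
    (hG : IsGolayLike G) {e : Fin 16 ≃ (Fin 4 → ZMod 2)}
    (he : IsAffineLabelling (reedSubcode G) e) {σ : Equiv.Perm (Fin 16)}
    (g : (Fin 4 → ZMod 2) ≃+ (Fin 4 → ZMod 2)) (hσ : ∀ x, σ (e.symm x) = e.symm (g x))
    (h : PreservesPair G 1 σ) (x : Fin 4 → ZMod 2) : g x = x := by
  have key : ∀ y, x ≠ 0 → y ≠ 0 → x ≠ y → g x = x ∨ g x = y ∨ g x = x + y := by
    intro y hx hy hxy
    obtain ⟨u, hu⟩ := hG.exists_head (he.plane_mem_dualCode x y)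
    have hr := add_mem_reedSubcode hu (h _ _ hu)
    simp only [add_comp, single_comp_symm, hσ, map_zero, map_add] at hr
    have hcancel : ∀ a b c d b' c' d' : BinVec 16,
        (a + b + c + d) + (a + b' + c' + d') = (b + c + d) + (b' + c' + d') := by
      intro a b c d b' c' d'
      have : (a + b + c + d) + (a + b' + c' + d') =
          (a + a) + ((b + c + d) + (b' + c' + d')) := by abel
      rw [this, binVec_add_self, zero_add]
    rw [hcancel] at hr
    have hle : ∀ v w : BinVec 16, wt (v + w) ≤ wt v + wt w := fun v w => by
      have := wt_add v w
      omega
    have hle3 : ∀ i j k : Fin 16,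
        wt (Pi.single i 1 + Pi.single j 1 + Pi.single k 1 : BinVec 16) ≤ 3 := by
      intro i j k
      have h1 := hle (Pi.single i 1 + Pi.single j 1) (Pi.single k 1)
      have h2 := hle (Pi.single i 1) (Pi.single j 1)
      rw [wt_single] at h1
      rw [wt_single, wt_single] at h2
      omega
    have h0 := hG.eq_zero_of_mem_reed hr (lt_of_le_of_lt (hle _ _)
      (lt_of_le_of_lt (Nat.add_le_add (hle3 _ _ _) (hle3 _ _ _)) (by norm_num)))
    by_contra! hne
    have := congrFun h0 (e.symm (g x))
    simp [hne.1, hne.2.1, hne.2.2, hxy, hy] at this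
  by_cases hx : x = 0
  · rw [hx, map_zero]
  obtain ⟨y, hy0, hyx, hy1, hy2⟩ := (by decide +kernel : ∀ x z : Fin 4 → ZMod 2,
    ∃ y, y ≠ 0 ∧ x ≠ y ∧ z ≠ y ∧ z ≠ x + y) x (g x)
  rcases key y hx hy0 hyx with h | h | h
  · exact h
  · exact absurd h hy1
  · exact absurd h hy2

/-- The isomorphism of the linear group of `F_2^4` with the alternating group of degree eight,
given by the action on the octad. -/
theorem IsGolayLike.nonempty_mulAut_mulEquiv {G : Submodule (ZMod 2) (BinVec 24)}
    (hG : IsGolayLike G) (h1 : concat 1 0 ∈ G) :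
    Nonempty (MulAut (Multiplicative (Fin 4 → ZMod 2)) ≃* alternatingGroup (Fin 8)) := by
  obtain ⟨e, he⟩ : ∃ e, IsAffineLabelling (reedSubcode G) e := hG.isReedMullerOneFour h1
  have hex : ∀ g : MulAut (Multiplicative (Fin 4 → ZMod 2)),
      ∃ τ, PreservesPair G τ (affinePermHom e (.inr g)) := fun g =>
    hG.exists_preservesPair h1 ((he.mem_range_affinePermHom _).1 ⟨_, rfl⟩)
  choose L hL using hex
  let f : MulAut (Multiplicative (Fin 4 → ZMod 2)) →* Equiv.Perm (Fin 8) :=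
    MonoidHom.mk' L fun g g' => hG.preservesPair_unique (hL (g * g')) (by
      rw [map_mul, map_mul]
      exact (hL g).mul (hL g'))
  have hf : Function.Injective f := by
    rw [injective_iff_map_eq_one]
    intro g hg
    have hg' := hL g
    rw [show L g = 1 from hg] at hg'
    ext1 x
    refine hG.eq_self_of_preservesPair_one he (AddEquiv.toMultiplicative.symm g) (fun x => ?_) hg' x
    apply e.injective
    rw [label_affinePermHom, Equiv.apply_symm_apply, Equiv.apply_symm_apply]
    exact add_zero _
  have hindex : f.range.index = 2 := by
    have h := Subgroup.card_mul_index f.range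
    rw [← Nat.card_congr (MonoidHom.ofInjective hf).toEquiv, card_mulAut_multiplicative,
      Nat.card_perm, Nat.card_fin] at h
    have : Nat.factorial 8 = 20160 * 2 := by decide
    omega
  rw [← Equiv.Perm.eq_alternatingGroup_of_index_eq_two hindex]
  exact ⟨MonoidHom.ofInjective hf⟩

theorem corollary3p3 (G : Submodule (ZMod 2) (BinVec 24)) (hG : IsExtendedGolay G)
    (hoctad : concat 1 0 ∈ G) :
    ((reedSubcode G : Set (BinVec 16)) ⊆ nordstromRobinson G ∧
      IsReedMullerOneFour (reedSubcode G)) ∧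
    ((codeCoordAction (nordstromRobinson G)).ker.map (codeAut (nordstromRobinson G)).subtype
        = translationGroup (reedSubcode G) ∧
      Nat.card (codeCoordAction (nordstromRobinson G)).ker = 2 ^ 5) ∧
    ∃ φ : alternatingGroup (Fin 8) →* MulAut (Multiplicative (Fin 4 → ZMod 2)),
      Function.Injective φ ∧
      Nonempty ((codeAut (nordstromRobinson G) ⧸ (codeCoordAction (nordstromRobinson G)).ker) ≃*
        (Multiplicative (Fin 4 → ZMod 2) ⋊[φ] alternatingGroup (Fin 8))) := by
  have hG := hG.isGolayLike
  refine ⟨⟨reedSubcode_subset, hG.isReedMullerOneFour hoctad⟩,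
    ⟨hG.map_ker_codeCoordAction, hG.card_ker_codeCoordAction hoctad⟩, ?_⟩
  obtain ⟨ψ⟩ := hG.nonempty_mulAut_mulEquiv hoctad
  obtain ⟨e, he⟩ : ∃ e, IsAffineLabelling (reedSubcode G) e := hG.isReedMullerOneFour hoctad
  refine ⟨ψ.symm.toMonoidHom, ψ.symm.injective, ⟨?_⟩⟩
  have hrange : (codeCoordAction (nordstromRobinson G)).range = (affinePermHom e).range := by
    ext σ
    rw [hG.mem_range_codeCoordAction hoctad, he.mem_range_affinePermHom]
  exact (QuotientGroup.quotientKerEquivRange _).trans ((MulEquiv.subgroupCongr hrange).trans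
    ((MonoidHom.ofInjective (affinePermHom_injective e)).symm.trans
      (SemidirectProduct.congr (MulEquiv.refl _) ψ fun g => by ext; simp)))
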